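/- Let $1<\gamma<3$, $A>0$, $\rho_0>0$ be constants, and put $P(\rho)=A\rho^\gamma$, $c(\rho)=\sqrt{P'(\rho)}$, $h(\rho)=\frac{c^2(\rho)}{\gamma-1}$ for $\rho>0$. For $n\in\{2,3\}$ and $b_0>0$, a self-similar background solution consists of a number $s_0>b_0$ and differentiable functions $\rho>0$ and $u$ on $[b_0,s_0]$ (derivatives at the end points being one-sided) such that $(s-u)^2-c^2(\rho)$ does not vanish on $[b_0,s_0]$ and (2.1) $\displaystyle \rho'(s)=\frac{(n-1)(s-u)\rho u}{s\left((s-u)^2-c^2(\rho)\right)},\qquad u'(s)=\frac{(n-1)c^2(\rho)u}{s\left((s-u)^2-c^2(\rho)\right)}\qquad (b_0\le s\le s_0),$ (2.2) $s_0\left(\rho(s_0)-\rho_0\right)-\rho(s_0)u(s_0)=0,\qquad s_0u(s_0)-\left(\tfrac12u(s_0)^2+h(\rho(s_0))-h(\rho_0)\right)=0,$ (2.3) $u(s_0)-c(\rho(s_0))<s_0<u(s_0)+c(\rho(s_0)),\qquad c(\rho_0)<s_0,$ (2.4) $u(b_0)=b_0.$ **Lemma 2.1.** There are positive constants $B$ and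 $C$, depending only on $\gamma$, $A$ and $\rho_0$, such that for $n\in\{2,3\}$ and every $b_0\ge B$, every self-similar background solution $(s_0,\rho,u)$ satisfies the following for all $s\in[b_0,s_0]$. Here $\theta$ stands for a quantity, different in each item and possibly depending on everything, with $|\theta|\le C\left(b_0^{-2/(\gamma-1)}+b_0^{-2}\right)$. (i) $s_0=b_0(1+\theta)$. (ii) $u(s)=b_0(1+\theta)$. (iii) $\rho(s)=\left(\frac{\gamma-1}{2A\gamma}\right)^{\frac1{\gamma-1}}b_0^{\frac2{\gamma-1}}(1+\theta)$. (iv) $u^2(s)-c^2(\rho(s))=\frac{3-\gamma}2b_0^2(1+\theta)>0$. (v) $(s-u(s))^2-c^2(\rho(s))=-\frac{\gamma-1}2b_0^2(1+\theta)<0$. (vi) $u(s)+c(\rho(s))-s=\sqrt{\frac{\gamma-1}2}\,b_0(1+\theta)>0$. (vii) $u(s)-c(\rho(s))-s=-\sqrt{\frac{\gamma-1}2}\,b_0(1+\theta)<0$. (viii) $|\rho'(s)|\le C\,b_0^{-1}$. (ix) $u'(s)=-(n-1)(1+\theta)<0$. -/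

import Mathlib

open Set

noncomputable section

namespace PistonFlow

/-- Pressure law `P(ρ) = A ρ ^ γ` of a polytropic gas. -/
def pressure (A γ ρ : ℝ) : ℝ := A * ρ ^ γ

/-- Local sound speed `c(ρ) = √(P'(ρ))`. -/
def soundSpeed (A γ ρ : ℝ) : ℝ := √(deriv (pressure A γ) ρ)

/-- Specific enthalpy `h(ρ) = c(ρ)² / (γ - 1)`. -/
def enthalpy (A γ ρ : ℝ) : ℝ := soundSpeed A γ ρ ^ 2 / (γ - 1)

/-- For positive density the sound speed is `√(A γ ρ ^ (γ - 1))`. -/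
theorem soundSpeed_of_pos {A γ ρ : ℝ} (hρ : 0 < ρ) :
    soundSpeed A γ ρ = √(A * γ * ρ ^ (γ - 1)) := by
  have h : HasDerivAt (pressure A γ) (A * (γ * ρ ^ (γ - 1))) ρ :=
    (Real.hasDerivAt_rpow_const (Or.inl hρ.ne')).const_mul A
  rw [soundSpeed, h.deriv, mul_assoc]

/-- The common denominator factor `(s - u)² - c²(ρ)` of the self-similar system. -/
def denom (A γ s ρ u : ℝ) : ℝ := (s - u) ^ 2 - soundSpeed A γ ρ ^ 2

/-- `(s₀, ρ, u)` is a self-similar background solution for the piston `r = b₀ t` expanding in the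
static gas of density `ρ₀` in `n` space dimensions: `r = s₀ t` is the shock, and `ρ(r / t)` and
`u(r / t)` are the density and the radial velocity between the piston and the shock.
Derivatives at the two end points of `[b₀, s₀]` are one-sided. -/
structure IsBackgroundSolution (n : ℕ) (A γ ρ₀ b₀ s₀ : ℝ) (ρ u : ℝ → ℝ) : Prop where
  /-- The shock lies ahead of the piston. -/
  shock_ahead : b₀ < s₀
  /-- The density is positive. -/
  density_pos : ∀ s ∈ Icc b₀ s₀, 0 < ρ s
  /-- The system is meaningful: its denominator does not vanish. -/
  denom_ne_zero : ∀ s ∈ Icc b₀ s₀, denom A γ s (ρ s) (u s) ≠ 0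
  /-- The equation for `ρ'`. -/
  density_ode : ∀ s ∈ Icc b₀ s₀,
    HasDerivWithinAt ρ
      (((n : ℝ) - 1) * (s - u s) * ρ s * u s / (s * denom A γ s (ρ s) (u s))) (Icc b₀ s₀) s
  /-- The equation for `u'`. -/
  velocity_ode : ∀ s ∈ Icc b₀ s₀,
    HasDerivWithinAt u
      (((n : ℝ) - 1) * soundSpeed A γ (ρ s) ^ 2 * u s / (s * denom A γ s (ρ s) (u s)))
      (Icc b₀ s₀) s
  /-- Rankine-Hugoniot condition for the mass, `s₀ [ρ] - [ρ u] = 0`; the gas ahead is at rest. -/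
  rh_mass : s₀ * (ρ s₀ - ρ₀) - (ρ s₀ * u s₀ - ρ₀ * 0) = 0
  /-- Rankine-Hugoniot condition `s₀ [u] - [u² / 2 + h(ρ)] = 0`. -/
  rh_bernoulli : s₀ * (u s₀ - 0) -
    ((u s₀ ^ 2 / 2 + enthalpy A γ (ρ s₀)) - (0 ^ 2 / 2 + enthalpy A γ ρ₀)) = 0
  /-- Lax entropy conditions on the shock. -/
  lax_left : u s₀ - soundSpeed A γ (ρ s₀) < s₀
  lax_right : s₀ < u s₀ + soundSpeed A γ (ρ s₀)
  lax_ahead : soundSpeed A γ ρ₀ < s₀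
  /-- Solid wall condition on the piston. -/
  piston : u b₀ = b₀

/-- `x = m (1 + O(b₀ ^ (-2 / (γ - 1))) + O(b₀ ^ (-2)))`, with `C` as the constant in the `O`s. -/
def ApproxRel (C γ b₀ x m : ℝ) : Prop :=
  ∃ θ : ℝ, |θ| ≤ C * (b₀ ^ (-(2 / (γ - 1))) + b₀ ^ (-2 : ℝ)) ∧ x = m * (1 + θ)

end PistonFlow

end

namespace PistonFlow

/-! For a fast piston the shock is strong and the gas behind it is nearly a constant state moving
with the piston. The Lax conditions make the denominator negative at the shock, hence everywhere
(`denom_neg`). With `u > 0` this makes `u` nonincreasing, so the lag `s - u` lies between `0`, its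
value at the piston, and `σ = s₀ - u s₀` (`lag_mem`). Since `(c²)' = (γ - 1) (s - u) u'`, the
variation of `c²` is at most `(γ - 1) σ²` (`soundSpeed_sq_mem`). The jump conditions give `σ = s₀ q`
and `c² = c₀² + (γ - 1) / 2 * s₀² (1 - q²)` at the shock, where `q = ρ₀ / ρ s₀` (`shock_relations`).
They force `q = O(b₀ ^ (-2 / (γ - 1)))` (`inv_compression_le`), which is the first error term; the
second, `b₀ ^ (-2)`, is `c₀²` relative to `b₀²`. So `s`, `u` and `c²` are close to `b₀`, `b₀` and
`(γ - 1) / 2 * b₀²` (`exists_background_bounds`), and the remaining estimates are perturbations of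
algebraic expressions in these. -/

theorem pos_of_continuousOn_of_ne_zero {f : ℝ → ℝ} {S : Set ℝ} (hS : IsPreconnected S)
    (hf : ContinuousOn f S) (h0 : ∀ x ∈ S, f x ≠ 0) {y : ℝ} (hy : y ∈ S) (hfy : 0 < f y) :
    ∀ x ∈ S, 0 < f x := by
  intro x hx
  by_contra hneg
  obtain ⟨z, hz, hz0⟩ := hS.intermediate_value hx hy hf ⟨not_lt.mp hneg, hfy.le⟩
  exact h0 z hz hz0

/-- A solution of a linear homogeneous equation with bounded coefficient keeps its sign. -/
theorem pos_of_linear_ode {a b : ℝ} (hab : a ≤ b) {f g : ℝ → ℝ} (hg : ContinuousOn g (Icc a b))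
    (hf : ∀ x ∈ Icc a b, HasDerivWithinAt f (g x * f x) (Icc a b) x) (hfa : 0 < f a) :
    ∀ x ∈ Icc a b, 0 < f x := by
  have hfc : ContinuousOn f (Icc a b) := fun x hx => (hf x hx).continuousWithinAt
  -- As `|g| ≤ M`, the weight `exp (2 M x)` makes `f²` times it nondecreasing, so `f` cannot reach
  -- zero.
  obtain ⟨M, hM⟩ := isCompact_Icc.exists_bound_of_continuousOn hg
  have hder : ∀ x ∈ Icc a b, HasDerivWithinAt (fun x => f x ^ 2 * Real.exp (2 * M * x))
      (2 * (g x + M) * (f x ^ 2 * Real.exp (2 * M * x))) (Icc a b) x := by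
    intro x hx
    have h1 := (hf x hx).pow 2
    have h2 : HasDerivWithinAt (fun x => Real.exp (2 * M * x))
        (Real.exp (2 * M * x) * (2 * M)) (Icc a b) x := by
      have := ((hasDerivAt_id x).const_mul (2 * M)).exp.hasDerivWithinAt (s := Icc a b)
      simpa using this
    refine (h1.mul h2).congr_deriv ?_
    simp
    ring
  have hmono : MonotoneOn (fun x => f x ^ 2 * Real.exp (2 * M * x)) (Icc a b) := by
    refine monotoneOn_of_hasDerivWithinAt_nonneg (convex_Icc a b)
      (fun x hx => (hder x hx).continuousWithinAt)
      (fun x hx => (hder x (interior_subset hx)).mono interior_subset) ?_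
    intro x hx
    have := hM x (interior_subset hx)
    rw [Real.norm_eq_abs] at this
    have : 0 ≤ g x + M := by linarith [neg_abs_le (g x)]
    positivity
  refine pos_of_continuousOn_of_ne_zero isPreconnected_Icc hfc ?_ (left_mem_Icc.mpr hab) hfa
  intro x hx h0
  have := hmono (left_mem_Icc.mpr hab) hx hx.1
  simp only [h0] at this
  have h3 : 0 < f a ^ 2 * Real.exp (2 * M * a) := by positivity
  norm_num at this
  linarith

theorem soundSpeed_sq {A γ ρ : ℝ} (hA : 0 ≤ A) (hγ : 0 ≤ γ) (hρ : 0 < ρ) :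
    soundSpeed A γ ρ ^ 2 = A * γ * ρ ^ (γ - 1) := by
  rw [soundSpeed_of_pos hρ, Real.sq_sqrt (by positivity)]

theorem soundSpeed_nonneg (A γ ρ : ℝ) : 0 ≤ soundSpeed A γ ρ := Real.sqrt_nonneg _

/-! ### Signs and monotonicity along a background solution -/

namespace IsBackgroundSolution

variable {n : ℕ} {A γ ρ₀ b₀ s₀ : ℝ} {ρ u : ℝ → ℝ}

theorem continuousOn_density (h : IsBackgroundSolution n A γ ρ₀ b₀ s₀ ρ u) :
    ContinuousOn ρ (Icc b₀ s₀) := fun s hs => (h.density_ode s hs).continuousWithinAt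

theorem continuousOn_velocity (h : IsBackgroundSolution n A γ ρ₀ b₀ s₀ ρ u) :
    ContinuousOn u (Icc b₀ s₀) := fun s hs => (h.velocity_ode s hs).continuousWithinAt

theorem continuousOn_soundSpeed_sq (h : IsBackgroundSolution n A γ ρ₀ b₀ s₀ ρ u) (hA : 0 ≤ A)
    (hγ : 0 ≤ γ) : ContinuousOn (fun s => soundSpeed A γ (ρ s) ^ 2) (Icc b₀ s₀) := by
  have h1 : ContinuousOn (fun s => A * γ * ρ s ^ (γ - 1)) (Icc b₀ s₀) :=
    continuousOn_const.mul
      (h.continuousOn_density.rpow_const fun s hs => Or.inl (h.density_pos s hs).ne')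
  exact h1.congr fun s hs => soundSpeed_sq hA hγ (h.density_pos s hs)

theorem continuousOn_denom (h : IsBackgroundSolution n A γ ρ₀ b₀ s₀ ρ u) (hA : 0 ≤ A)
    (hγ : 0 ≤ γ) : ContinuousOn (fun s => denom A γ s (ρ s) (u s)) (Icc b₀ s₀) :=
  ((continuousOn_id.sub h.continuousOn_velocity).pow 2).sub (h.continuousOn_soundSpeed_sq hA hγ)

/-- The Lax conditions say `|s₀ - u s₀| < c` behind the shock; a continuous nonvanishing denominator
keeps that sign up to the piston. -/
theorem denom_neg (h : IsBackgroundSolution n A γ ρ₀ b₀ s₀ ρ u) (hA : 0 ≤ A) (hγ : 0 ≤ γ) :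
    ∀ s ∈ Icc b₀ s₀, denom A γ s (ρ s) (u s) < 0 := by
  intro s hs
  have h0 : 0 < -denom A γ s₀ (ρ s₀) (u s₀) := by
    have h1 := h.lax_left
    have h2 := h.lax_right
    rw [denom]
    nlinarith
  have := pos_of_continuousOn_of_ne_zero isPreconnected_Icc (h.continuousOn_denom hA hγ).neg
    (fun x hx => neg_ne_zero.mpr (h.denom_ne_zero x hx))
    (right_mem_Icc.mpr h.shock_ahead.le) h0 s hs
  simpa using this

theorem velocity_pos (h : IsBackgroundSolution n A γ ρ₀ b₀ s₀ ρ u) (hA : 0 ≤ A) (hγ : 0 ≤ γ)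
    (hb : 0 < b₀) : ∀ s ∈ Icc b₀ s₀, 0 < u s := by
  refine pos_of_linear_ode (g := fun s => ((n : ℝ) - 1) * soundSpeed A γ (ρ s) ^ 2 /
    (s * denom A γ s (ρ s) (u s))) h.shock_ahead.le ?_ ?_ (by rwa [h.piston])
  · refine (continuousOn_const.mul (h.continuousOn_soundSpeed_sq hA hγ)).div
      (continuousOn_id.mul (h.continuousOn_denom hA hγ)) fun s hs => ?_
    exact mul_ne_zero (hb.trans_le hs.1).ne' (h.denom_ne_zero s hs)
  · intro s hs
    exact (h.velocity_ode s hs).congr_deriv (by ring)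

/-- The right-hand side of the velocity equation is nonpositive. -/
theorem velocity_rhs_nonpos (h : IsBackgroundSolution n A γ ρ₀ b₀ s₀ ρ u) (hn : 1 ≤ n)
    (hA : 0 ≤ A) (hγ : 0 ≤ γ) (hb : 0 < b₀) : ∀ s ∈ Icc b₀ s₀,
    ((n : ℝ) - 1) * soundSpeed A γ (ρ s) ^ 2 * u s / (s * denom A γ s (ρ s) (u s)) ≤ 0 := by
  intro s hs
  have hu := h.velocity_pos hA hγ hb s hs
  have hn' : (0 : ℝ) ≤ (n : ℝ) - 1 := by
    have : (1 : ℝ) ≤ n := by exact_mod_cast hn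
    linarith
  exact div_nonpos_of_nonneg_of_nonpos (by positivity)
    (mul_nonpos_of_nonneg_of_nonpos (hb.le.trans hs.1) (h.denom_neg hA hγ s hs).le)

theorem velocity_antitone (h : IsBackgroundSolution n A γ ρ₀ b₀ s₀ ρ u) (hn : 1 ≤ n)
    (hA : 0 ≤ A) (hγ : 0 ≤ γ) (hb : 0 < b₀) : AntitoneOn u (Icc b₀ s₀) :=
  antitoneOn_of_hasDerivWithinAt_nonpos (convex_Icc b₀ s₀) h.continuousOn_velocity
    (fun x hx => (h.velocity_ode x (interior_subset hx)).mono interior_subset)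
    (fun x hx => h.velocity_rhs_nonpos hn hA hγ hb x (interior_subset hx))

/-- The differentiated Bernoulli law `(c²)' = (γ - 1) (s - u) u'`. -/
theorem hasDerivWithinAt_soundSpeed_sq (h : IsBackgroundSolution n A γ ρ₀ b₀ s₀ ρ u)
    (hA : 0 ≤ A) (hγ : 0 ≤ γ) : ∀ s ∈ Icc b₀ s₀,
    HasDerivWithinAt (fun s => soundSpeed A γ (ρ s) ^ 2)
      ((γ - 1) * (s - u s) *
        (((n : ℝ) - 1) * soundSpeed A γ (ρ s) ^ 2 * u s / (s * denom A γ s (ρ s) (u s))))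
      (Icc b₀ s₀) s := by
  intro s hs
  have hρ := h.density_pos s hs
  have h1 := ((h.density_ode s hs).rpow_const (p := γ - 1) (Or.inl hρ.ne')).const_mul (A * γ)
  have h2 : HasDerivWithinAt (fun s => soundSpeed A γ (ρ s) ^ 2) _ (Icc b₀ s₀) s :=
    h1.congr (fun x hx => soundSpeed_sq hA hγ (h.density_pos x hx)) (soundSpeed_sq hA hγ hρ)
  refine h2.congr_deriv ?_
  rw [soundSpeed_sq hA hγ hρ, Real.rpow_sub_one hρ.ne' (γ - 1)]
  field_simp

theorem lag_mem (h : IsBackgroundSolution n A γ ρ₀ b₀ s₀ ρ u) (hn : 1 ≤ n)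
    (hA : 0 ≤ A) (hγ : 0 ≤ γ) (hb : 0 < b₀) : ∀ s ∈ Icc b₀ s₀,
    0 ≤ s - u s ∧ s - u s ≤ s₀ - u s₀ := by
  intro s hs
  have hu := h.velocity_antitone hn hA hγ hb
  have h1 := hu (left_mem_Icc.mpr h.shock_ahead.le) hs hs.1
  have h2 := hu hs (right_mem_Icc.mpr h.shock_ahead.le) hs.2
  rw [h.piston] at h1
  exact ⟨by linarith [hs.1], by linarith [hs.2]⟩

/-- The sound speed varies between piston and shock by at most the square of the lag there. -/
theorem soundSpeed_sq_mem (h : IsBackgroundSolution n A γ ρ₀ b₀ s₀ ρ u) (hn : 1 ≤ n)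
    (hA : 0 ≤ A) (hγ : 1 ≤ γ) (hb : 0 < b₀) : ∀ s ∈ Icc b₀ s₀,
    soundSpeed A γ (ρ s₀) ^ 2 ≤ soundSpeed A γ (ρ s) ^ 2 ∧
    soundSpeed A γ (ρ s) ^ 2 ≤ soundSpeed A γ (ρ s₀) ^ 2 + (γ - 1) * (s₀ - u s₀) ^ 2 := by
  intro s hs
  have hγ0 : 0 ≤ γ := by linarith
  have hγ1 : 0 ≤ γ - 1 := by linarith
  have hs₀ := right_mem_Icc.mpr h.shock_ahead.le
  have hw := h.hasDerivWithinAt_soundSpeed_sq hA hγ0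
  constructor
  · refine antitoneOn_of_hasDerivWithinAt_nonpos (convex_Icc b₀ s₀)
      (h.continuousOn_soundSpeed_sq hA hγ0)
      (fun x hx => (hw x (interior_subset hx)).mono interior_subset) ?_ hs hs₀ hs.2
    intro x hx
    exact mul_nonpos_of_nonneg_of_nonpos
      (mul_nonneg hγ1 (h.lag_mem hn hA hγ0 hb x (interior_subset hx)).1)
      (h.velocity_rhs_nonpos hn hA hγ0 hb x (interior_subset hx))
  -- With `σ = s₀ - u s₀`, the derivative of `c² - (γ - 1) σ u` is `(γ - 1) (s - u - σ) u'`, a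
  -- product of two nonpositive factors.
  · have hd : ∀ x ∈ Icc b₀ s₀, HasDerivWithinAt
        (fun s => soundSpeed A γ (ρ s) ^ 2 - (γ - 1) * (s₀ - u s₀) * u s) _ (Icc b₀ s₀) x :=
      fun x hx => (hw x hx).sub ((h.velocity_ode x hx).const_mul ((γ - 1) * (s₀ - u s₀)))
    have hm := monotoneOn_of_hasDerivWithinAt_nonneg (convex_Icc b₀ s₀)
      (fun x hx => (hd x hx).continuousWithinAt)
      (fun x hx => (hd x (interior_subset hx)).mono interior_subset) (by
        intro x hx
        rw [← sub_mul, ← mul_sub]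
        exact mul_nonneg_of_nonpos_of_nonpos
          (mul_nonpos_of_nonneg_of_nonpos hγ1
            (by linarith [(h.lag_mem hn hA hγ0 hb x (interior_subset hx)).2]))
          (h.velocity_rhs_nonpos hn hA hγ0 hb x (interior_subset hx))) hs hs₀ hs.2
    have hu := h.velocity_antitone hn hA hγ0 hb
    have h1 := hu (left_mem_Icc.mpr h.shock_ahead.le) hs hs.1
    rw [h.piston] at h1
    have h2 : 0 ≤ s₀ - u s₀ := (h.lag_mem hn hA hγ0 hb s₀ hs₀).1
    have h3 : u s - u s₀ ≤ s₀ - u s₀ := by linarith [h.shock_ahead]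
    have h4 := mul_le_mul_of_nonneg_left h3 (mul_nonneg hγ1 h2)
    simp only at hm
    nlinarith

/-- Mass conservation reads `u = s₀ (1 - q)` with `q = ρ₀ / ρ s₀`, so that `s₀ u - u² / 2 = s₀² (1 -
q²) / 2` in the Bernoulli condition. Compression follows from `u > 0`. -/
theorem shock_relations (h : IsBackgroundSolution n A γ ρ₀ b₀ s₀ ρ u)
    (hA : 0 < A) (hγ : 1 < γ) (hb : 0 < b₀) :
    ρ₀ < ρ s₀ ∧ s₀ - u s₀ = s₀ * (ρ₀ / ρ s₀) ∧
    soundSpeed A γ (ρ s₀) ^ 2 =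
      soundSpeed A γ ρ₀ ^ 2 + (γ - 1) / 2 * s₀ ^ 2 * (1 - (ρ₀ / ρ s₀) ^ 2) := by
  have hs₀ := right_mem_Icc.mpr h.shock_ahead.le
  have hρ := h.density_pos s₀ hs₀
  have hs : 0 < s₀ := hb.trans h.shock_ahead
  have hu := h.velocity_pos hA.le (by linarith) hb s₀ hs₀
  have h1 := h.rh_mass
  have h2 := h.rh_bernoulli
  simp only [enthalpy] at h2
  have hk : γ - 1 ≠ 0 := by linarith
  have h3 : s₀ - u s₀ = s₀ * (ρ₀ / ρ s₀) := by
    field_simp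
    linarith
  refine ⟨?_, h3, ?_⟩
  · have : 0 < s₀ * (ρ s₀ - ρ₀) := by
      have := mul_pos hρ hu
      linarith
    linarith [pos_of_mul_pos_right this hs.le]
  · have h4 : u s₀ = s₀ * (1 - ρ₀ / ρ s₀) := by linarith
    rw [h4] at h2
    field_simp at h2 ⊢
    linarith

end IsBackgroundSolution

/-! ### Strong shocks and closeness to the constant state -/

/-- A shock into gas of sound speed `√w` whose speed is large compresses the gas strongly. -/
theorem inv_compression_le {k w s r : ℝ} (hk : 0 < k) (hk2 : k ≤ 2) (hw : 0 < w) (hs : 0 < s)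
    (hr : 1 < r) (hsw : 4 * w ≤ k * s ^ 2)
    (h : w * r ^ k = w + k / 2 * s ^ 2 * (1 - r⁻¹ ^ 2)) :
    r⁻¹ ≤ (4 * w / k) ^ (1 / k) * s ^ (-(2 / k)) := by
  have hr0 : 0 < r := by linarith
  have h1 : r ^ k ≤ r ^ 2 := by
    rw [← Real.rpow_natCast]
    exact Real.rpow_le_rpow_of_exponent_le hr.le (by simpa using hk2)
  have hq : 0 < 1 - r⁻¹ ^ 2 := by
    have : r⁻¹ < 1 := inv_lt_one_of_one_lt₀ hr
    have : 0 < r⁻¹ := by positivity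
    nlinarith
  -- Replacing `r ^ k` by `r ^ 2` lets the factor `1 - r⁻²` cancel. This rules out `r` near the
  -- trivial root `1`; the resulting `r² ≥ 2` then gives the sharp power.
  have h2 : k / 2 * s ^ 2 ≤ w * r ^ 2 := by
    have h3 : k / 2 * s ^ 2 * (1 - r⁻¹ ^ 2) ≤ w * r ^ 2 * (1 - r⁻¹ ^ 2) := by
      have : w * r ^ 2 * (1 - r⁻¹ ^ 2) = w * r ^ 2 - w := by field_simp
      nlinarith
    exact le_of_mul_le_mul_right h3 hq
  have h3 : 2 ≤ r ^ 2 := by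
    have : w * 2 ≤ w * r ^ 2 := by linarith
    exact le_of_mul_le_mul_left this hw
  have h4 : r⁻¹ ^ 2 ≤ 1 / 2 := by
    rw [inv_pow, inv_le_comm₀ (by positivity) (by norm_num)]
    simpa using h3
  have h5 : k / 4 * s ^ 2 ≤ w * r ^ k := by
    have : k / 2 * s ^ 2 * (1 / 2) ≤ k / 2 * s ^ 2 * (1 - r⁻¹ ^ 2) := by
      gcongr
      linarith
    linarith
  have h6 : r⁻¹ ^ k ≤ 4 * w / k * s ^ (-2 : ℝ) := by
    rw [Real.inv_rpow hr0.le, Real.rpow_neg hs.le, Real.rpow_two, ← div_eq_mul_inv,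
      le_div_iff₀ (by positivity), inv_mul_le_iff₀ (by positivity), mul_div_assoc',
      le_div_iff₀ hk]
    linarith
  have h7 := Real.rpow_le_rpow (by positivity) h6 (by positivity : 0 ≤ 1 / k)
  rw [← Real.rpow_mul (by positivity), mul_one_div_cancel hk.ne', Real.rpow_one,
    Real.mul_rpow (by positivity) (by positivity), ← Real.rpow_mul hs.le] at h7
  convert h7 using 3
  ring

theorem abs_sub_le_of_strong_shock {k w W b s q : ℝ} (hk : 0 ≤ k) (hk2 : k ≤ 2) (hw : 0 ≤ w)
    (hb : 0 < b) (hbs : b ≤ s) (hq : 0 ≤ q) (hq2 : q ≤ 1 / 2) (hs : s - b ≤ 2 * b * q)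
    (hl : w + k / 2 * s ^ 2 * (1 - q ^ 2) ≤ W)
    (hu : W ≤ w + k / 2 * s ^ 2 * (1 - q ^ 2) + k * (s * q) ^ 2) :
    |W - k / 2 * b ^ 2| ≤ 10 * (b ^ 2 * q) + w := by
  have hs0 : 0 < s := hb.trans_le hbs
  have hb2q : 0 ≤ b ^ 2 * q := by positivity
  have hqq : b ^ 2 * q ^ 2 ≤ b ^ 2 * q * (1 / 2) := by
    have := mul_le_mul_of_nonneg_left hq2 hb2q
    linarith
  have hsl : b ^ 2 ≤ s ^ 2 := by gcongr
  have hsu : s ^ 2 ≤ b ^ 2 + 6 * (b ^ 2 * q) := by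
    have : s ^ 2 ≤ (b + 2 * b * q) ^ 2 := by
      gcongr
      linarith
    linarith
  have hsq : (s * q) ^ 2 ≤ 2 * (b ^ 2 * q) := by
    have : s * q ≤ 2 * b * q := by
      gcongr
      have := mul_le_mul_of_nonneg_left hq2 hb.le
      linarith
    have : (s * q) ^ 2 ≤ (2 * b * q) ^ 2 := by gcongr
    linarith
  have h1 : k / 2 * (s ^ 2 * q ^ 2) ≤ k / 2 * (2 * (b ^ 2 * q)) := by
    rw [← mul_pow]
    exact mul_le_mul_of_nonneg_left hsq (by positivity)
  have h2 : k / 2 * b ^ 2 ≤ k / 2 * s ^ 2 := by gcongr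
  have h3 : k / 2 * s ^ 2 ≤ k / 2 * (b ^ 2 + 6 * (b ^ 2 * q)) := by gcongr
  have h4 : k * (s * q) ^ 2 ≤ k * (2 * (b ^ 2 * q)) := by gcongr
  have h5 : k * (b ^ 2 * q) ≤ 2 * (b ^ 2 * q) := by gcongr
  have h6 : 0 ≤ k / 2 * (s ^ 2 * q ^ 2) := by positivity
  rw [abs_le]
  constructor <;> linarith

/-- Distance of a background solution with piston speed `b` from the constant state moving with
the piston. -/
theorem exists_background_bounds {γ A ρ₀ : ℝ} (hγ₁ : 1 < γ) (hγ₃ : γ ≤ 3) (hA : 0 < A)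
    (hρ₀ : 0 < ρ₀) :
    ∃ B K : ℝ, 0 < B ∧ 0 < K ∧ ∀ n : ℕ, 1 ≤ n → ∀ b : ℝ, B ≤ b →
      ∀ (s₀ : ℝ) (ρ u : ℝ → ℝ), IsBackgroundSolution n A γ ρ₀ b s₀ ρ u →
      ∀ s ∈ Icc b s₀,
        s - b ≤ K * (b ^ (-(2 / (γ - 1))) + b ^ (-2 : ℝ)) * b ∧
        u s ≤ b ∧ b - u s ≤ K * (b ^ (-(2 / (γ - 1))) + b ^ (-2 : ℝ)) * b ∧
        |soundSpeed A γ (ρ s) ^ 2 - (γ - 1) / 2 * b ^ 2| ≤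
          K * (b ^ (-(2 / (γ - 1))) + b ^ (-2 : ℝ)) * b ^ 2 ∧
        s - u s ≤ K * b ^ (-(2 / (γ - 1))) * b := by
  have hk : 0 < γ - 1 := by linarith
  set k := γ - 1 with hkdef
  set w := soundSpeed A γ ρ₀ ^ 2 with hw
  have hwρ : w = A * γ * ρ₀ ^ k := soundSpeed_sq hA.le (by linarith) hρ₀
  have hγ0 : 0 < γ := by linarith
  have hw0 : 0 < w := by rw [hwρ]; positivity
  set L := (4 * w / k) ^ (1 / k) with hL
  have hL0 : 0 < L := by positivity
  have ht : Filter.Tendsto (fun b : ℝ => L * b ^ (-(2 / k))) Filter.atTop (nhds 0) := by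
    simpa using (tendsto_rpow_neg_atTop (by positivity : 0 < 2 / k)).const_mul L
  have ht2 : Filter.Tendsto (fun b : ℝ => k * b ^ 2) Filter.atTop Filter.atTop :=
    (Filter.tendsto_pow_atTop two_ne_zero).const_mul_atTop hk
  -- The first condition yields `q ≤ 1 / 2`, the second is the strength hypothesis of
  -- `inv_compression_le`.
  obtain ⟨B, hB⟩ := Filter.eventually_atTop.mp
    ((ht.eventually_le_const (by norm_num : (0 : ℝ) < 1 / 2)).and
      (ht2.eventually_ge_atTop (4 * w)))
  refine ⟨max B 1, 10 * L + w, by positivity, by positivity, ?_⟩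
  intro n hn b hb s₀ ρ u h s hs
  have hb0 : 0 < b := lt_of_lt_of_le one_pos ((le_max_right _ _).trans hb)
  obtain ⟨hB1, hB2⟩ := hB b ((le_max_left _ _).trans hb)
  have hsb := h.shock_ahead
  have hs₀ : 0 < s₀ := hb0.trans hsb
  have hs₀m := right_mem_Icc.mpr hsb.le
  obtain ⟨hr, hσ, hw1⟩ := h.shock_relations hA hγ₁ hb0
  have hρ1 := h.density_pos s₀ hs₀m
  set q := ρ₀ / ρ s₀ with hq
  have hq0 : 0 < q := by positivity
  have hqL : q ≤ L * b ^ (-(2 / k)) := by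
    have hqi : q = (ρ s₀ / ρ₀)⁻¹ := by rw [inv_div]
    have h1 : q ≤ L * s₀ ^ (-(2 / k)) := by
      rw [hqi]
      refine inv_compression_le hk (by linarith) hw0 hs₀ ((one_lt_div hρ₀).mpr hr) ?_ ?_
      · have : b ^ 2 ≤ s₀ ^ 2 := by gcongr
        nlinarith
      · rw [← hqi, ← hw1, soundSpeed_sq hA.le hγ0.le hρ1, hwρ,
          Real.div_rpow hρ1.le hρ₀.le, ← hkdef]
        have : ρ₀ ^ k ≠ 0 := by positivity
        field_simp
    have h2 : s₀ ^ (-(2 / k)) ≤ b ^ (-(2 / k)) :=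
      Real.rpow_le_rpow_of_nonpos hb0 hsb.le (by simp; positivity)
    exact h1.trans (by gcongr)
  set ε := b ^ (-(2 / k)) with hε
  have hε0 : 0 < ε := by positivity
  have hδ : b ^ (-2 : ℝ) * b ^ 2 = 1 := by
    rw [Real.rpow_neg hb0.le, Real.rpow_two, inv_mul_cancel₀ (by positivity)]
  set δ := b ^ (-2 : ℝ) with hδdef
  have hδ0 : 0 < δ := by positivity
  have hq2 : q ≤ 1 / 2 := hqL.trans hB1
  have hua := h.velocity_antitone hn hA.le hγ0.le hb0
  have hu0 : u s ≤ b := h.piston ▸ hua (left_mem_Icc.mpr hsb.le) hs hs.1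
  have hu1 : u s₀ ≤ b := h.piston ▸ hua (left_mem_Icc.mpr hsb.le) hs₀m hsb.le
  have hlag := h.lag_mem hn hA.le hγ0.le hb0 s hs
  obtain ⟨hwl, hwu⟩ := h.soundSpeed_sq_mem hn hA.le hγ₁.le hb0 s hs
  rw [hw1] at hwl hwu
  rw [hσ] at hlag hwu
  have hs2 : s₀ ≤ 2 * b := by
    have := mul_le_mul_of_nonneg_left hq2 hs₀.le
    linarith
  have hσ2 : s₀ * q ≤ 2 * b * q := by gcongr
  have hqb : 2 * b * q ≤ 2 * L * ε * b := by
    have := mul_le_mul_of_nonneg_left hqL hb0.le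
    linarith
  have hcoef : 2 * L * ε ≤ (10 * L + w) * ε ∧ (10 * L + w) * ε ≤ (10 * L + w) * (ε + δ) := by
    constructor
    · gcongr; linarith
    · gcongr; linarith
  have hc1 := mul_le_mul_of_nonneg_right hcoef.1 hb0.le
  have hc2 := mul_le_mul_of_nonneg_right hcoef.2 hb0.le
  have hsb2 : s₀ - b ≤ 2 * b * q := by linarith
  refine ⟨by linarith [hs.2], hu0, by linarith [hs.1], ?_, by linarith⟩
  refine (abs_sub_le_of_strong_shock hk.le (by linarith) hw0.le hb0 hsb.le hq0.le hq2
    (by linarith) hwl hwu).trans ?_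
  have hbq : b ^ 2 * q ≤ b ^ 2 * (L * ε) := by gcongr
  have : (10 * L + w) * (ε + δ) * b ^ 2 =
    10 * (b ^ 2 * (L * ε)) + w * (δ * b ^ 2) + 10 * L * δ * b ^ 2 + w * ε * b ^ 2 := by ring
  rw [this, hδ]
  have : 0 ≤ 10 * L * δ * b ^ 2 + w * ε * b ^ 2 := by positivity
  linarith

/-! ### Relative errors -/

namespace ApproxRel

variable {C γ b x m : ℝ}

theorem of_abs_sub_le (hm : m ≠ 0)
    (h : |x - m| ≤ C * (b ^ (-(2 / (γ - 1))) + b ^ (-2 : ℝ)) * |m|) : ApproxRel C γ b x m := by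
  refine ⟨(x - m) / m, ?_, by field_simp; ring⟩
  rwa [abs_div, div_le_iff₀ (abs_pos.mpr hm)]

theorem mem_Icc (h : ApproxRel C γ b x m)
    (hC : C * (b ^ (-(2 / (γ - 1))) + b ^ (-2 : ℝ)) ≤ 1 / 2) (hm : 0 ≤ m) :
    x ∈ Icc (m / 2) (3 / 2 * m) := by
  obtain ⟨θ, hθ, rfl⟩ := h
  have := abs_le.mp (hθ.trans hC)
  constructor <;> nlinarith

theorem neg (h : ApproxRel C γ b x (-m)) : ApproxRel C γ b (-x) m := by
  obtain ⟨θ, hθ, rfl⟩ := h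
  exact ⟨θ, hθ, by ring⟩

end ApproxRel

theorem exists_abs_one_add_rpow_sub_one_le (p : ℝ) :
    ∃ C : ℝ, 0 < C ∧ ∀ x : ℝ, |x| ≤ 1 / 2 → |(1 + x) ^ p - 1| ≤ C * |x| := by
  have hd : ∀ y ∈ Icc (1 / 2 : ℝ) (3 / 2), HasDerivWithinAt (fun y : ℝ => y ^ p)
      (p * y ^ (p - 1)) (Icc (1 / 2) (3 / 2)) y := fun y hy =>
    (Real.hasDerivAt_rpow_const (Or.inl (by linarith [hy.1] : (0 : ℝ) < y).ne')).hasDerivWithinAt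
  have hc : ContinuousOn (fun y : ℝ => p * y ^ (p - 1)) (Icc (1 / 2 : ℝ) (3 / 2)) :=
    continuousOn_const.mul (continuousOn_id.rpow_const
      fun y hy => Or.inl (by linarith [hy.1] : (0 : ℝ) < y).ne')
  obtain ⟨M, hM⟩ := isCompact_Icc.exists_bound_of_continuousOn hc
  refine ⟨max M 1, by positivity, fun x hx => ?_⟩
  obtain ⟨h1, h2⟩ := abs_le.mp hx
  have := (convex_Icc (1 / 2 : ℝ) (3 / 2)).norm_image_sub_le_of_norm_hasDerivWithin_le hd hM
    (x := 1) (y := 1 + x) ⟨by norm_num, by norm_num⟩ ⟨by linarith, by linarith⟩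
  simp only [Real.one_rpow, Real.norm_eq_abs, add_sub_cancel_left] at this
  exact this.trans (by gcongr; exact le_max_left _ _)

theorem abs_sqrt_sub_sqrt_le {x y : ℝ} (hx : 0 ≤ x) (hy : 0 < y) : |√x - √y| ≤ |x - y| / √y := by
  have h : 0 < √y := Real.sqrt_pos.mpr hy
  rw [le_div_iff₀ h]
  have : x - y = (√x - √y) * (√x + √y) := by
    linarith [Real.mul_self_sqrt hx, Real.mul_self_sqrt hy.le]
  rw [this, abs_mul]
  gcongr
  rw [abs_of_nonneg (by positivity)]
  linarith [Real.sqrt_nonneg x]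

/-- Relative error of a quotient `(1 + α) (1 + β) / ((1 + μ) (1 + ν))`. -/
theorem abs_quotient_sub_one_le {α β μ ν e : ℝ} (hα : |α| ≤ e) (hβ : |β| ≤ e) (hμ : |μ| ≤ e)
    (hν : |ν| ≤ e) (he : e ≤ 1 / 2) :
    |(1 + α) * (1 + β) / ((1 + μ) * (1 + ν)) - 1| ≤ 20 * e := by
  have he0 : 0 ≤ e := (abs_nonneg _).trans hα
  have hμ' := abs_le.mp hμ
  have hν' := abs_le.mp hν
  have hden : 1 / 4 ≤ (1 + μ) * (1 + ν) := by nlinarith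
  have h : (1 + α) * (1 + β) / ((1 + μ) * (1 + ν)) - 1 =
      (α + β + α * β - μ - ν - μ * ν) / ((1 + μ) * (1 + ν)) := by
    rw [div_sub_one (by linarith)]
    ring
  rw [h, abs_div, abs_of_pos (by linarith : 0 < (1 + μ) * (1 + ν)), div_le_iff₀ (by linarith)]
  have h1 : |α * β| ≤ 1 / 2 * e := by
    rw [abs_mul]
    exact mul_le_mul (hα.trans he) hβ (abs_nonneg _) (by norm_num)
  have h2 : |μ * ν| ≤ 1 / 2 * e := by
    rw [abs_mul]
    exact mul_le_mul (hμ.trans he) hν (abs_nonneg _) (by norm_num)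
  have h3 : |α + β + α * β - μ - ν - μ * ν| ≤ 5 * e := by
    have := abs_le.mp hα
    have := abs_le.mp hβ
    have := abs_le.mp h1
    have := abs_le.mp h2
    rw [abs_le]
    constructor <;> linarith
  nlinarith

/-! ### Perturbation of the algebraic expressions -/

section NearConstantState

variable {k b e s u w : ℝ}

theorem abs_sq_sub_sub_le (hb : 0 < b) (he : e ≤ 1)
    (hub : u ≤ b) (hu : b - u ≤ e * b) (hw : |w - k / 2 * b ^ 2| ≤ e * b ^ 2) :
    |u ^ 2 - w - (1 - k / 2) * b ^ 2| ≤ 4 * e * b ^ 2 := by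
  obtain ⟨h1, h2⟩ := abs_le.mp hw
  have hub2 : |b - u| ≤ e * b := abs_le.mpr ⟨by linarith, hu⟩
  have h3 : |b ^ 2 - u ^ 2| ≤ 3 * e * b ^ 2 := by
    have : |b + u| ≤ 3 * b := by
      have : e * b ≤ 1 * b := by gcongr
      exact abs_le.mpr ⟨by linarith, by linarith⟩
    rw [show b ^ 2 - u ^ 2 = (b - u) * (b + u) by ring, abs_mul,
      show 3 * e * b ^ 2 = e * b * (3 * b) by ring]
    exact mul_le_mul hub2 this (abs_nonneg _) ((abs_nonneg _).trans hub2)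
  obtain ⟨h4, h5⟩ := abs_le.mp h3
  rw [abs_le]
  constructor <;> linarith

theorem abs_lag_sq_sub_sub_le (hb : 0 < b) (he : e ≤ 1) (hus : u ≤ s) (hsu : s - u ≤ e * b)
    (hw : |w - k / 2 * b ^ 2| ≤ e * b ^ 2) :
    |(s - u) ^ 2 - w - -(k / 2 * b ^ 2)| ≤ 2 * e * b ^ 2 := by
  obtain ⟨h1, h2⟩ := abs_le.mp hw
  have he0 : 0 ≤ e := nonneg_of_mul_nonneg_left (by linarith) hb
  have h3 : (s - u) ^ 2 ≤ e * b ^ 2 := by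
    have h4 : (s - u) ^ 2 ≤ (e * b) ^ 2 := by
      have : 0 ≤ s - u := by linarith
      gcongr
    have h5 : e * (e * b ^ 2) ≤ 1 * (e * b ^ 2) := by gcongr
    linarith
  rw [abs_le]
  constructor <;> nlinarith [sq_nonneg (s - u)]

theorem abs_sqrt_sub_sqrt_mul_le (hk : 0 < k) (hb : 0 < b) (hw0 : 0 ≤ w)
    (hw : |w - k / 2 * b ^ 2| ≤ e * b ^ 2) : |√w - √(k / 2) * b| ≤ e * b / √(k / 2) := by
  have h := abs_sqrt_sub_sqrt_le hw0 (by positivity : 0 < k / 2 * b ^ 2)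
  have h0 : 0 < √(k / 2) := Real.sqrt_pos.mpr (by positivity)
  rw [Real.sqrt_mul (by positivity), Real.sqrt_sq hb.le] at h
  refine h.trans ?_
  rw [div_le_div_iff₀ (by positivity) h0]
  have := mul_le_mul_of_nonneg_right hw h0.le
  linarith

/-- The characteristic speeds relative to `s` are close to `±√(k / 2) b`. -/
theorem abs_characteristic_sub_le (hk : 0 < k) (hb : 0 < b) (hw0 : 0 ≤ w) (hus : u ≤ s)
    (hsu : s - u ≤ e * b) (hw : |w - k / 2 * b ^ 2| ≤ e * b ^ 2) :
    |u + √w - s - √(k / 2) * b| ≤ (1 / √(k / 2) + 2 / k) * e * (√(k / 2) * b) ∧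
    |u - √w - s - -(√(k / 2) * b)| ≤ (1 / √(k / 2) + 2 / k) * e * (√(k / 2) * b) := by
  have h0 : 0 < √(k / 2) := Real.sqrt_pos.mpr (by positivity)
  have hsq : √(k / 2) ^ 2 = k / 2 := Real.sq_sqrt (by positivity)
  obtain ⟨h1, h2⟩ := abs_le.mp (abs_sqrt_sub_sqrt_mul_le hk hb hw0 hw)
  have h3 : (1 / √(k / 2) + 2 / k) * e * (√(k / 2) * b) = e * b + e * b / √(k / 2) := by
    have : 2 / k = 1 / √(k / 2) ^ 2 := by rw [hsq]; field_simp
    rw [this]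
    field_simp
  rw [h3]
  constructor <;> rw [abs_le] <;> constructor <;> linarith

theorem abs_relative_soundSpeed_sq_le (hk : 0 < k) (hb : 0 < b)
    (hw : |w - k / 2 * b ^ 2| ≤ e * b ^ 2) : |w / (k / 2 * b ^ 2) - 1| ≤ 2 / k * e := by
  have h : 0 < k / 2 * b ^ 2 := by positivity
  rw [div_sub_one h.ne', abs_div, abs_of_pos h, div_le_iff₀ h]
  have : 2 / k * e * (k / 2 * b ^ 2) = e * b ^ 2 := by field_simp
  linarith

theorem abs_velocity_slope_sub_le {N : ℝ} (hN : 0 ≤ N) (hk : 0 < k) (hk2 : k ≤ 2) (hb : 0 < b)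
    (he : 4 / k * e ≤ 1 / 2) (hbs : b ≤ s) (hs : s - b ≤ e * b)
    (hub : u ≤ b) (hu : b - u ≤ e * b) (hsu : s - u ≤ e * b)
    (hw : |w - k / 2 * b ^ 2| ≤ e * b ^ 2) :
    |N * w * u / (s * ((s - u) ^ 2 - w)) - -N| ≤ 80 / k * e * N := by
  have he0 : 0 ≤ e := nonneg_of_mul_nonneg_left (by linarith) hb
  -- `4 / k * e` serves as common bound for the four relative errors; the denominator attains it,
  -- and `k ≤ 2` covers `u / b` and `s / b`.
  have h4k : 1 * e ≤ 4 / k * e := by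
    gcongr
    rw [le_div_iff₀ hk]
    linarith
  have hα : |w / (k / 2 * b ^ 2) - 1| ≤ 4 / k * e :=
    (abs_relative_soundSpeed_sq_le hk hb hw).trans (by gcongr; norm_num)
  have hβ : |u / b - 1| ≤ 4 / k * e := by
    rw [div_sub_one hb.ne', abs_div, abs_of_pos hb, div_le_iff₀ hb, abs_le]
    have := mul_le_mul_of_nonneg_right h4k hb.le
    constructor <;> linarith
  have hμ : |s / b - 1| ≤ 4 / k * e := by
    rw [div_sub_one hb.ne', abs_div, abs_of_pos hb, div_le_iff₀ hb, abs_le]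
    have := mul_le_mul_of_nonneg_right h4k hb.le
    constructor <;> linarith
  have hν : |(w - (s - u) ^ 2) / (k / 2 * b ^ 2) - 1| ≤ 4 / k * e := by
    have h1 := abs_lag_sq_sub_sub_le hb (by linarith) (hub.trans hbs) hsu hw
    have h : 0 < k / 2 * b ^ 2 := by positivity
    rw [div_sub_one h.ne', abs_div, abs_of_pos h, div_le_iff₀ h, abs_sub_comm]
    rw [show k / 2 * b ^ 2 - (w - (s - u) ^ 2) = (s - u) ^ 2 - w - -(k / 2 * b ^ 2) by ring]
    refine h1.trans_eq ?_
    field_simp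
    ring
  have h := abs_quotient_sub_one_le hα hβ hμ hν he
  simp only [add_sub_cancel] at h
  have hkb : 0 < k / 2 * b ^ 2 := by positivity
  have hq : w / (k / 2 * b ^ 2) * (u / b) / (s / b * ((w - (s - u) ^ 2) / (k / 2 * b ^ 2))) =
      w * u / (s * (w - (s - u) ^ 2)) := by
    rw [div_mul_div_comm, div_mul_div_comm, mul_comm b (k / 2 * b ^ 2),
      div_div_div_cancel_right₀ (by positivity)]
  rw [hq] at h
  have : N * w * u / (s * ((s - u) ^ 2 - w)) - -N = -N * (w * u / (s * (w - (s - u) ^ 2)) - 1) := by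
    rw [← neg_sub w ((s - u) ^ 2), mul_neg, div_neg]
    ring
  rw [this, abs_mul, abs_neg, abs_of_nonneg hN]
  have := mul_le_mul_of_nonneg_left h hN
  linarith [show N * (20 * (4 / k * e)) = 80 / k * e * N by ring]

/-- The density is the power `1 / k` of `c² / a`, so its ratio to the reference density is `(1 + x)
^ (1 / k)`, where `x` is the relative error of `c²`. -/
theorem abs_density_sub_le {a M ρ : ℝ} (ha : 0 < a) (hk : 0 < k) (hb : 0 < b) (hρ : 0 < ρ)
    (hM0 : 0 ≤ M) (hM : ∀ x : ℝ, |x| ≤ 1 / 2 → |(1 + x) ^ (1 / k) - 1| ≤ M * |x|)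
    (he : 2 / k * e ≤ 1 / 2) (hw : |a * ρ ^ k - k / 2 * b ^ 2| ≤ e * b ^ 2) :
    |ρ - (k / (2 * a)) ^ (1 / k) * b ^ (2 / k)| ≤
      M * (2 / k) * e * ((k / (2 * a)) ^ (1 / k) * b ^ (2 / k)) := by
  have h1 := abs_relative_soundSpeed_sq_le hk hb hw
  have h2 := hM _ (h1.trans he)
  rw [add_sub_cancel] at h2
  have hbk : b ^ (2 / k) = (b ^ 2) ^ (1 / k) := by
    rw [← Real.rpow_natCast, ← Real.rpow_mul hb.le]
    congr 1
    push_cast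
    ring
  have h3 : (k / (2 * a)) ^ (1 / k) * b ^ (2 / k) * (a * ρ ^ k / (k / 2 * b ^ 2)) ^ (1 / k) = ρ := by
    rw [hbk, ← Real.mul_rpow (by positivity) (by positivity),
      ← Real.mul_rpow (by positivity) (by positivity),
      show k / (2 * a) * b ^ 2 * (a * ρ ^ k / (k / 2 * b ^ 2)) = ρ ^ k by field_simp,
      ← Real.rpow_mul hρ.le, mul_one_div_cancel hk.ne', Real.rpow_one]
  have hm : 0 < (k / (2 * a)) ^ (1 / k) * b ^ (2 / k) := by positivity
  set m := (k / (2 * a)) ^ (1 / k) * b ^ (2 / k)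
  set y := (a * ρ ^ k / (k / 2 * b ^ 2)) ^ (1 / k)
  have h4 : |ρ - m| = m * |y - 1| := by
    rw [← abs_of_pos hm, ← abs_mul, abs_of_pos hm, mul_sub, h3, mul_one]
  rw [h4]
  have h5 := mul_le_mul_of_nonneg_left (h2.trans (mul_le_mul_of_nonneg_left h1 hM0)) hm.le
  linarith

end NearConstantState

/-- Size of the right-hand side of the density equation. -/
theorem abs_density_slope_le {N k b s u ρ D K m ε κ : ℝ} (hN0 : 0 ≤ N) (hN : N ≤ 2) (hk : 0 < k)
    (hb : 0 < b) (hbs : b ≤ s) (hu0 : 0 < u) (hus : u ≤ s) (hsu : s - u ≤ K * ε * b)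
    (hρ0 : 0 < ρ) (hρ : ρ ≤ 3 / 2 * m) (hmε : m * ε = κ)
    (hD : D ≤ -(k / 4 * b ^ 2)) :
    |N * (s - u) * ρ * u / (s * D)| ≤ 12 * K * κ / k * b⁻¹ := by
  have hs : 0 < s := hb.trans_le hbs
  have hkb : 0 < k / 4 * b ^ 2 := by positivity
  have hD' : k / 4 * b ^ 2 ≤ |D| := by
    rw [abs_of_neg (by linarith)]
    linarith
  have hsu0 : 0 ≤ s - u := by linarith
  rw [abs_div, abs_mul s, abs_of_pos hs, abs_of_nonneg (by positivity),
    div_le_iff₀ (mul_pos hs (hkb.trans_le hD'))]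
  have hKε : 0 ≤ K * ε * b := by linarith
  have h1 : (s - u) * ρ ≤ K * ε * b * (3 / 2 * m) := by gcongr
  have h2 : K * ε * b * (3 / 2 * m) = 3 / 2 * K * κ * b := by
    rw [← hmε]
    ring
  have h3 : 0 ≤ (s - u) * ρ := by positivity
  have h4 : N * ((s - u) * ρ) * u ≤ 2 * (3 / 2 * K * κ * b) * s := by
    rw [h2] at h1
    have : 0 ≤ 3 / 2 * K * κ * b := h3.trans h1
    gcongr
  have h5 : 0 ≤ 12 * K * κ / k * b⁻¹ * s := by
    have : 0 ≤ K * κ := by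
      have : 0 ≤ K * κ * b := by linarith
      exact nonneg_of_mul_nonneg_left this hb
    rw [mul_assoc 12 K κ]
    positivity
  have h6 := mul_le_mul_of_nonneg_left hD' h5
  have h7 : 12 * K * κ / k * b⁻¹ * s * (k / 4 * b ^ 2) = 2 * (3 / 2 * K * κ * b) * s := by
    field_simp
    ring
  linarith

end PistonFlow

/-! ### Choice of constants and assembly -/

open PistonFlow in
theorem lemma2p1 (γ A ρ₀ : ℝ) (hγ₁ : 1 < γ) (hγ₃ : γ < 3) (hA : 0 < A) (hρ₀ : 0 < ρ₀) :
    ∃ B C : ℝ, 0 < B ∧ 0 < C ∧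
      ∀ n : ℕ, n = 2 ∨ n = 3 →
      ∀ b₀ : ℝ, B ≤ b₀ →
      ∀ (s₀ : ℝ) (ρ u : ℝ → ℝ), IsBackgroundSolution n A γ ρ₀ b₀ s₀ ρ u →
        ApproxRel C γ b₀ s₀ b₀ ∧
        ∀ s ∈ Set.Icc b₀ s₀,
          ApproxRel C γ b₀ (u s) b₀ ∧
          ApproxRel C γ b₀ (ρ s)
            (((γ - 1) / (2 * A * γ)) ^ (1 / (γ - 1)) * b₀ ^ (2 / (γ - 1))) ∧
          (ApproxRel C γ b₀ (u s ^ 2 - soundSpeed A γ (ρ s) ^ 2) ((3 - γ) / 2 * b₀ ^ 2) ∧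
            0 < u s ^ 2 - soundSpeed A γ (ρ s) ^ 2) ∧
          (ApproxRel C γ b₀ ((s - u s) ^ 2 - soundSpeed A γ (ρ s) ^ 2)
              (-((γ - 1) / 2 * b₀ ^ 2)) ∧
            (s - u s) ^ 2 - soundSpeed A γ (ρ s) ^ 2 < 0) ∧
          (ApproxRel C γ b₀ (u s + soundSpeed A γ (ρ s) - s) (√((γ - 1) / 2) * b₀) ∧
            0 < u s + soundSpeed A γ (ρ s) - s) ∧
          (ApproxRel C γ b₀ (u s - soundSpeed A γ (ρ s) - s) (-(√((γ - 1) / 2) * b₀)) ∧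
            u s - soundSpeed A γ (ρ s) - s < 0) ∧
          |derivWithin ρ (Set.Icc b₀ s₀) s| ≤ C * b₀⁻¹ ∧
          (ApproxRel C γ b₀ (derivWithin u (Set.Icc b₀ s₀) s) (-((n : ℝ) - 1)) ∧
            derivWithin u (Set.Icc b₀ s₀) s < 0) := by
  have hk : 0 < γ - 1 := by linarith
  have hγ0 : 0 < γ := by linarith
  obtain ⟨B, K, hB, hK, hcore⟩ := exists_background_bounds hγ₁ hγ₃.le hA hρ₀
  obtain ⟨M, hM, hrpow⟩ := exists_abs_one_add_rpow_sub_one_le (1 / (γ - 1))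
  have hsq0 : 0 < √((γ - 1) / 2) := Real.sqrt_pos.mpr (by positivity)
  have h3γ : 0 < 3 - γ := by linarith
  set κ := ((γ - 1) / (2 * A * γ)) ^ (1 / (γ - 1)) with hκ
  have hκ0 : 0 < κ := by positivity
  obtain ⟨C, hC0, hC1, hC3, hC4, hC5, hC6, hC8, hC9⟩ : ∃ C : ℝ, 0 < C ∧ 1 * K ≤ C ∧
      M * (2 / (γ - 1)) * K ≤ C ∧ 8 / (3 - γ) * K ≤ C ∧ 4 / (γ - 1) * K ≤ C ∧
      (1 / √((γ - 1) / 2) + 2 / (γ - 1)) * K ≤ C ∧ 12 * K * κ / (γ - 1) ≤ C ∧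
      80 / (γ - 1) * K ≤ C := by
    obtain ⟨C, hC⟩ := Finset.bddAbove (α := ℝ) {1 * K, M * (2 / (γ - 1)) * K,
      8 / (3 - γ) * K, 4 / (γ - 1) * K, (1 / √((γ - 1) / 2) + 2 / (γ - 1)) * K,
      12 * K * κ / (γ - 1), 80 / (γ - 1) * K}
    simp only [Finset.coe_insert, Finset.coe_singleton, mem_upperBounds, Set.mem_insert_iff,
      Set.mem_singleton_iff, forall_eq_or_imp, forall_eq] at hC
    exact ⟨C, by linarith, hC⟩
  have ht : Filter.Tendsto (fun b : ℝ => C * (b ^ (-(2 / (γ - 1))) + b ^ (-2 : ℝ)))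
      Filter.atTop (nhds 0) := by
    simpa using ((tendsto_rpow_neg_atTop (by positivity : 0 < 2 / (γ - 1))).add
      (tendsto_rpow_neg_atTop (by norm_num : (0 : ℝ) < 2))).const_mul C
  obtain ⟨B', hB'⟩ := Filter.eventually_atTop.mp
    (ht.eventually_le_const (by norm_num : (0 : ℝ) < 1 / 2))
  refine ⟨max B B', C, by positivity, hC0, ?_⟩
  intro n hn b hb s₀ ρ u h
  have hb0 : 0 < b := hB.trans_le ((le_max_left _ _).trans hb)
  have hCE := hB' b ((le_max_right _ _).trans hb)
  have hε : κ * b ^ (2 / (γ - 1)) * b ^ (-(2 / (γ - 1))) = κ := by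
    rw [mul_assoc, ← Real.rpow_add hb0, add_neg_cancel, Real.rpow_zero, mul_one]
  have hε0 : 0 < b ^ (-(2 / (γ - 1))) := by positivity
  have hδ0 : 0 < b ^ (-2 : ℝ) := by positivity
  have hsb := h.shock_ahead
  have hn1 : 1 ≤ n := by omega
  have hN1 : (1 : ℝ) ≤ (n : ℝ) - 1 ∧ (n : ℝ) - 1 ≤ 2 := by
    rcases hn with rfl | rfl <;> norm_num
  have happ : ∀ {c x m : ℝ}, c * K ≤ C → m ≠ 0 →
      |x - m| ≤ c * (K * (b ^ (-(2 / (γ - 1))) + b ^ (-2 : ℝ))) * |m| →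
      ApproxRel C γ b x m := by
    intro c x m hc hm hx
    refine ApproxRel.of_abs_sub_le hm (hx.trans ?_)
    rw [← mul_assoc]
    gcongr
  have hsmall : ∀ {c : ℝ}, c * K ≤ C →
      c * (K * (b ^ (-(2 / (γ - 1))) + b ^ (-2 : ℝ))) ≤ 1 / 2 := by
    intro c hc
    refine le_trans ?_ hCE
    rw [← mul_assoc]
    gcongr
  have hcore' := hcore n hn1 b ((le_max_left _ _).trans hb) s₀ ρ u h
  have hlagE : K * b ^ (-(2 / (γ - 1))) * b ≤
      K * (b ^ (-(2 / (γ - 1))) + b ^ (-2 : ℝ)) * b := by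
    gcongr
    linarith
  set e := K * (b ^ (-(2 / (γ - 1))) + b ^ (-2 : ℝ)) with he
  have he0 : 0 < e := by positivity
  have he1 : e ≤ 1 / 2 := by linarith [hsmall hC1]
  have hk2 : γ - 1 ≤ 2 := by linarith
  refine ⟨happ hC1 hb0.ne' ?_, fun s hs => ?_⟩
  · have := (hcore' s₀ (Set.right_mem_Icc.mpr hsb.le)).1
    rw [abs_of_pos hb0, one_mul, abs_of_pos (by linarith)]
    exact this
  obtain ⟨h1, h2, h3, h4, h5⟩ := hcore' s hs
  have h5' := h5.trans hlagE
  have hρ := h.density_pos s hs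
  have hu := h.velocity_pos hA.le hγ0.le hb0 s hs
  have hc := soundSpeed_sq hA.le hγ0.le hρ
  have hcs := Real.sqrt_sq (soundSpeed_nonneg A γ (ρ s))
  have hus : u s ≤ s := h2.trans hs.1
  have hmρ : 0 < κ * b ^ (2 / (γ - 1)) := by positivity
  have happρ : ApproxRel C γ b (ρ s) (κ * b ^ (2 / (γ - 1))) := by
    refine happ hC3 hmρ.ne' ?_
    rw [abs_of_pos hmρ, hκ, mul_assoc 2 A γ]
    refine abs_density_sub_le (by positivity) hk hb0 hρ hM.le hrpow ?_ (by rwa [← hc])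
    refine le_trans ?_ (hsmall hC5)
    gcongr
    norm_num
  have happ4 : ApproxRel C γ b (u s ^ 2 - soundSpeed A γ (ρ s) ^ 2) ((3 - γ) / 2 * b ^ 2) := by
    refine happ hC4 (by positivity) ?_
    rw [abs_of_pos (by positivity : 0 < (3 - γ) / 2 * b ^ 2),
      show (3 - γ) / 2 = 1 - (γ - 1) / 2 by ring]
    refine (abs_sq_sub_sub_le hb0 (by linarith) h2 h3 h4).trans_eq ?_
    rw [show 1 - (γ - 1) / 2 = (3 - γ) / 2 by ring]
    field_simp
    norm_num
  have happ5 : ApproxRel C γ b ((s - u s) ^ 2 - soundSpeed A γ (ρ s) ^ 2)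
      (-((γ - 1) / 2 * b ^ 2)) := by
    refine happ hC5 (neg_ne_zero.mpr (by positivity)) ?_
    rw [abs_neg, abs_of_pos (by positivity : 0 < (γ - 1) / 2 * b ^ 2)]
    convert abs_lag_sq_sub_sub_le hb0 (by linarith) hus h5' h4 using 1
    field_simp
    norm_num
  have hchar := abs_characteristic_sub_le hk hb0 (sq_nonneg _) hus h5' h4
  rw [hcs] at hchar
  have hm6 : 0 < √((γ - 1) / 2) * b := by positivity
  have happ6 : ApproxRel C γ b (u s + soundSpeed A γ (ρ s) - s) (√((γ - 1) / 2) * b) := by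
    refine happ hC6 hm6.ne' ?_
    rw [abs_of_pos hm6]
    exact hchar.1
  have happ7 : ApproxRel C γ b (u s - soundSpeed A γ (ρ s) - s) (-(√((γ - 1) / 2) * b)) := by
    refine happ hC6 (neg_ne_zero.mpr hm6.ne') ?_
    rw [abs_neg, abs_of_pos hm6]
    exact hchar.2
  have hud := uniqueDiffOn_Icc hsb s hs
  have happ9 : ApproxRel C γ b (derivWithin u (Set.Icc b s₀) s) (-((n : ℝ) - 1)) := by
    rw [(h.velocity_ode s hs).derivWithin hud]
    refine happ hC9 (by linarith) ?_
    rw [abs_neg, abs_of_pos (by linarith : (0 : ℝ) < (n : ℝ) - 1)]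
    exact abs_velocity_slope_sub_le (by linarith) hk hk2 hb0 (hsmall hC5) hs.1 h1 h2 h3 h5' h4
  -- The threshold for `b` keeps `|θ| ≤ 1 / 2`, so each quantity has the sign of its leading term
  -- and at least half its size.
  have hD := (happ5.neg.mem_Icc hCE (by positivity)).1
  have h4pos := (happ4.mem_Icc hCE (by positivity)).1
  have h6pos := (happ6.mem_Icc hCE hm6.le).1
  have h7neg := (happ7.neg.mem_Icc hCE hm6.le).1
  have h9neg := (happ9.neg.mem_Icc hCE (by linarith)).1
  have hkb : 0 < (γ - 1) / 2 * b ^ 2 := by positivity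
  have h3b : 0 < (3 - γ) / 2 * b ^ 2 := by positivity
  refine ⟨happ hC1 hb0.ne' ?_, happρ, ⟨happ4, by linarith⟩, ⟨happ5, by linarith⟩,
    ⟨happ6, by linarith⟩, ⟨happ7, by linarith⟩, ?_, ⟨happ9, by linarith⟩⟩
  · rw [abs_of_pos hb0, one_mul, abs_sub_comm, abs_of_nonneg (by linarith)]
    exact h3
  · rw [(h.density_ode s hs).derivWithin hud]
    -- The lag bound `h5`, free of `b ^ (-2)`, is essential: its power of `b` cancels the growth `b
    -- ^ (2 / (γ - 1))` of the density exactly.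
    refine (abs_density_slope_le (by linarith) hN1.2 hk hb0 hs.1 hu hus h5 hρ
      (happρ.mem_Icc hCE hmρ.le).2 hε ?_).trans (by gcongr)
    rw [denom]
    linarith
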